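/- For each $n\ge 1$ let $H_n^{(1)}$ and $H_n^{(2)}$ be two finite simple graphs on a common finite vertex set $V_n$, with edge sets $E(H_n^{(1)})$ and $E(H_n^{(2)})$, and let $c_n$ be positive integers with $c_n\to\infty$. Color every vertex of $V_n$ with one of $c_n$ colors, uniformly at random and independently of the other vertices; that is, the colors $(X_v)_{v\in V_n}$ are independent and $\mathbb P(X_v=a)=1/c_n$ for every $v \in V_n$ and every $a\in\{1,\dots,c_n\}$. For $i\in\{1,2\}$ let $$T(H_n^{(i)})=\big|\{\{u,v\}\in E(H_n^{(i)}) : X_u=X_v\}\big|$$ be the number of monochromatic edges of $H_n^{(i)}$; both numbers are computed from the same coloring. Suppose that, as $n\to\infty$, $$\frac{|E(H_n^{(1)})|}{c_n}\to\lambda_1,\qquad \frac{|E(H_n^{(2)})|}{c_n}\to\lambda_2,\qquad \frac{|E(H_n^{(1)})\cap E(H_n^{(2)})|}{c_n}\to\lambda_{1,2}$$ for constants $\lambda_1,\lambda_2,\lambda_{1,2}\ge 0$ with $\lambda_{1,2}\le\lambda_1$ and $\lambda_{1,2}\le\lambda_2$. Then, as $n\to\infty$, $$\begin{pmatrix} T(H_n^{(1)})\\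 T(H_n^{(2)})\end{pmatrix}\ \xrightarrow{\ d\ }\ \begin{pmatrix} Z_1+Z_{1,2}\\ Z_2+Z_{1,2}\end{pmatrix},$$ where $Z_1\sim\mathrm{Pois}(\lambda_1-\lambda_{1,2})$, $Z_2\sim\mathrm{Pois}(\lambda_2-\lambda_{1,2})$ and $Z_{1,2}\sim\mathrm{Pois}(\lambda_{1,2})$ are independent, and $\mathrm{Pois}(0)$ is the point mass at $0$. -/

import Mathlib

open MeasureTheory ProbabilityTheory Filter Topology

open scoped NNReal ENNReal

/-- `X v`, for `v` in the vertex set `V`, is the random color of `v`. The vertices are colored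
uniformly at random with `c` colors: every vertex receives each of the `c` colors with probability
`1 / c`, independently from the other vertices. -/
structure IsUniformColoring {Ω V : Type*} [MeasurableSpace Ω] {c : ℕ} (X : V → Ω → Fin c)
    (P : Measure Ω) : Prop where
  measurable : ∀ v, Measurable (X v)
  uniform : ∀ v a, P {ω | X v ω = a} = 1 / (c : ℝ≥0∞)
  indep : iIndepFun X P

/-- The edge `e` is monochromatic in the coloring `x`: all its vertices have the same color. -/
def IsMonochromatic {V C : Type*} (x : V → C) (e : Sym2 V) : Prop :=
  ∀ v ∈ e, ∀ w ∈ e, x v = x w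

/-- The number `T(H)` of monochromatic edges of the graph `H` in the coloring `x`. -/
noncomputable def monochromaticEdgeCount {V C : Type*} (H : SimpleGraph V) (x : V → C) : ℕ :=
  {e | e ∈ H.edgeSet ∧ IsMonochromatic x e}.ncard

/-! By Lévy's theorem it suffices to treat characteristic functions. That of the pair of counts is
the average over colorings of a product over edges of either graph, where a monochromatic edge `e`
contributes `z e`, `‖z e‖ = 1`, and any other edge contributes 1. This average is close to `exp (∑
(z e - 1) / c)`, the value for independent Poisson edges.

To see this, vertices are removed one at a time, the color of the removed vertex `v` being averaged
first. Given the other colors, each edge at `v` is monochromatic with probability `1 / c`. Two edges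
at `v` both are with probability `1 / c²`, so linearising the product costs `O(deg(v)² / c²)`
(`norm_expect_prod_sub_mul_le`). Choosing `v` of least positive degree gives `deg(v) ≤ D` with `D² =
O(#E)`, however large the maximal degree is. The costs then add up to `O(D * #E / c²)`
(`norm_expect_prod_sub_exp_le`), which is `O(c^(-1/2))` when `#E = O(c)`. -/

/-! ### Linearising products; a vertex of small degree -/

open Finset in
/-- Replacing a product of points `1 + w i` of the closed unit disc by its linear part. -/
theorem norm_prod_one_add_sub_one_sub_sum_le {ι : Type*} [DecidableEq ι] (s : Finset ι) (w : ι → ℂ)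
    (hw : ∀ i ∈ s, ‖1 + w i‖ ≤ 1) :
    ‖∏ i ∈ s, (1 + w i) - 1 - ∑ i ∈ s, w i‖ ≤ ∑ p ∈ s.offDiag, ‖w p.1‖ * ‖w p.2‖ := by
  induction s using Finset.induction_on with
  | empty => simp
  | insert a s ha ih =>
    have ih := ih fun i hi => hw i (mem_insert_of_mem hi)
    have hsub : s.offDiag ∪ s.image (fun i => (a, i)) ⊆ (insert a s).offDiag := by
      intro p
      simp only [mem_union, mem_offDiag, mem_image, mem_insert]
      rintro (h | ⟨i, hi, rfl⟩)
      · tauto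
      · exact ⟨Or.inl rfl, Or.inr hi, fun h => ha ((show a = i from h) ▸ hi)⟩
    have hdisj : Disjoint s.offDiag (s.image (fun i => (a, i))) := by
      rw [disjoint_left]
      intro p hp hp'
      simp only [mem_offDiag, mem_image] at hp hp'
      obtain ⟨i, -, rfl⟩ := hp'
      exact ha hp.1
    have hsum := sum_le_sum_of_subset_of_nonneg (f := fun p : ι × ι => ‖w p.1‖ * ‖w p.2‖) hsub
      fun p _ _ => by positivity
    rw [sum_union hdisj, sum_image (by intro i _ j _ h; simpa using h)] at hsum
    simp only [← mul_sum] at hsum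
    rw [prod_insert ha, sum_insert ha]
    -- The factor `1 + w a` does not enlarge the old error; the last term pays for the new pairs
    -- `(a, i)`.
    have heq : (1 + w a) * ∏ i ∈ s, (1 + w i) - 1 - (w a + ∑ i ∈ s, w i)
        = (1 + w a) * (∏ i ∈ s, (1 + w i) - 1 - ∑ i ∈ s, w i) + w a * ∑ i ∈ s, w i := by ring
    rw [heq]
    refine (norm_add_le _ _).trans (le_trans ?_ hsum)
    rw [norm_mul, norm_mul]
    refine add_le_add ?_ (mul_le_mul_of_nonneg_left (norm_sum_le _ _) (norm_nonneg _))
    exact (mul_le_of_le_one_left (norm_nonneg _) (hw a (mem_insert_self _ _))).trans ih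

open Finset in
/-- Every finite nonempty set of edges has a non-isolated vertex whose degree is at most the square
root of twice the number of edges. -/
theorem exists_vertex_degree_sq_le {V : Type*} [Fintype V] [DecidableEq V] (E : Finset (Sym2 V)) (hE : E.Nonempty) :
    ∃ v, {e ∈ E | v ∈ e}.Nonempty ∧ #{e ∈ E | v ∈ e} ^ 2 ≤ 2 * #E := by
  set S : Finset V := {v | {e ∈ E | v ∈ e}.Nonempty} with hS
  have hSne : S.Nonempty := by
    obtain ⟨e, he⟩ := hE
    induction e using Sym2.ind with
    | _ x y => exact ⟨x, by simpa [hS] using ⟨s(x, y), by simpa using he⟩⟩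
  -- Least positive degree `d`: the other ends of the edges at `v` lie in `S`, so `d ≤ #S`, and
  -- double counting gives `d² ≤ #S * d ≤ 2 * #E`.
  obtain ⟨v, hv, hmin⟩ := S.exists_min_image (fun v => #{e ∈ E | v ∈ e}) hSne
  refine ⟨v, by simpa [hS] using hv, ?_⟩
  have hsum : ∑ u ∈ S, #{e ∈ E | u ∈ e} ≤ 2 * #E := by
    have h := sum_card_bipartiteAbove_eq_sum_card_bipartiteBelow (s := S) (t := E)
      (fun u e => u ∈ e)
    simp only [bipartiteAbove, bipartiteBelow] at h
    rw [h, mul_comm]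
    refine sum_le_card_nsmul _ _ _ fun e _ => ?_
    induction e using Sym2.ind with
    | _ x y =>
      refine (card_le_card (t := {x, y}) fun u hu => ?_).trans card_le_two
      simpa using (mem_filter.1 hu).2
  have hmul : #S * #{e ∈ E | v ∈ e} ≤ 2 * #E :=
    (card_nsmul_le_sum S _ _ hmin).trans hsum
  have hcard : #{e ∈ E | v ∈ e} ≤ #S := by
    refine card_le_card_of_surjOn (fun u => s(v, u)) fun e he => ?_
    simp only [coe_filter, Set.mem_ofPred_eq] at he
    obtain ⟨heE, u, rfl⟩ := he
    refine ⟨u, ?_, rfl⟩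
    simp only [hS, coe_filter, mem_univ, true_and, Set.mem_ofPred_eq]
    exact ⟨s(v, u), by simp [heE]⟩
  nlinarith

/-! ### Averages over colorings -/

section Averages

open Finset
open scoped BigOperators

variable {V C : Type*} [Fintype V] [DecidableEq V] [Fintype C]

/-- Recoloring one vertex uniformly does not change the average over all colorings. -/
theorem expect_expect_update [Nonempty C] {K : Type*} [Semifield K] [CharZero K] (f : (V → C) → K) (v : V) :
    𝔼 x, 𝔼 a, f (Function.update x v a) = 𝔼 x, f x := by
  have h1 : 𝔼 x : V → C, 𝔼 a : C, f (Function.update x v a)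
      = 𝔼 p : (V → C) × C, f (Function.update p.1 v p.2) := by
    rw [← univ_product_univ, expect_product]
  have h2 : 𝔼 p : (V → C) × C, f p.1 = 𝔼 x, f x := by
    rw [← univ_product_univ, expect_product]
    simp [expect_const univ_nonempty]
  rw [h1, ← h2]
  -- Swapping the fresh color with the old color of `v` is an involution.
  let φ : (V → C) × C → (V → C) × C := fun p => (Function.update p.1 v p.2, p.1 v)
  have hφ : Function.Involutive φ := fun p => by simp [φ]
  exact Fintype.expect_equiv hφ.toPerm _ _ fun p => rfl

theorem expect_ite_eq_one [DecidableEq C] {K : Type*} [Semifield K] [CharZero K] (b : C) :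
    𝔼 a : C, (if b = a then (1 : K) else 0) = (Fintype.card C : K)⁻¹ := by
  simp [expect_eq_sum_div_card]

/-- Two distinct vertices both receive the same prescribed random color with
probability `c⁻²`. -/
theorem expect_expect_ite_eq_mul_ite_eq [DecidableEq C] [Nonempty C] {u w : V} (huw : u ≠ w) :
    𝔼 x : V → C, 𝔼 a : C, ((if x u = a then (1 : ℝ) else 0) * (if x w = a then 1 else 0))
      = ((Fintype.card C : ℝ)⁻¹) ^ 2 := by
  have h1 (x : V → C) : 𝔼 a : C, ((if x u = a then (1 : ℝ) else 0) * (if x w = a then 1 else 0))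
      = (Fintype.card C : ℝ)⁻¹ * (if x w = x u then 1 else 0) := by
    simp [expect_eq_sum_div_card, div_eq_inv_mul, eq_comm]
  simp_rw [h1]
  rw [← mul_expect, ← expect_expect_update _ u, sq]
  congr 1
  simp only [Function.update_self, Function.update_of_ne huw.symm]
  simp_rw [expect_ite_eq_one]
  exact expect_const univ_nonempty _

end Averages

/-! ### Edge factors -/

theorem isMonochromatic_mk {V C : Type*} {x : V → C} {u w : V} :
    IsMonochromatic x s(u, w) ↔ x u = x w := by
  simp only [IsMonochromatic, Sym2.mem_iff, forall_eq_or_imp, forall_eq, true_and, and_true]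
  exact ⟨fun h => h.1, fun h => ⟨h, h.symm⟩⟩

open Classical in
/-- The factor `z e` if the edge `e` is monochromatic in the coloring `x`, and `1` otherwise. -/
noncomputable def monochromaticFactor {V C : Type*} (z : Sym2 V → ℂ) (x : V → C) (e : Sym2 V) : ℂ :=
  if IsMonochromatic x e then z e else 1

theorem norm_monochromaticFactor_le {V C : Type*} {z : Sym2 V → ℂ} (hz : ∀ e, ‖z e‖ ≤ 1)
    (x : V → C) (e : Sym2 V) : ‖monochromaticFactor z x e‖ ≤ 1 := by
  unfold monochromaticFactor
  split_ifs <;> simp [hz]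

theorem monochromaticFactor_update_of_notMem {V C : Type*} [DecidableEq V] (z : Sym2 V → ℂ)
    (x : V → C) {v : V} (a : C) {e : Sym2 V} (hv : v ∉ e) :
    monochromaticFactor z (Function.update x v a) e = monochromaticFactor z x e := by
  induction e using Sym2.ind with
  | _ u w =>
    simp only [Sym2.mem_iff, not_or] at hv
    have h : IsMonochromatic (Function.update x v a) s(u, w) ↔ IsMonochromatic x s(u, w) := by
      rw [isMonochromatic_mk, isMonochromatic_mk, Function.update_of_ne (Ne.symm hv.1),
        Function.update_of_ne (Ne.symm hv.2)]
    classical exact if_congr h rfl rfl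

theorem monochromaticFactor_update_mk {V C : Type*} [DecidableEq V] [DecidableEq C]
    (z : Sym2 V → ℂ) (x : V → C) {v u : V} (a : C) (hu : u ≠ v) :
    monochromaticFactor z (Function.update x v a) s(v, u)
      = 1 + (if x u = a then 1 else 0) * (z s(v, u) - 1) := by
  simp only [monochromaticFactor, isMonochromatic_mk, Function.update_self,
    Function.update_of_ne hu, eq_comm (a := a)]
  split_ifs <;> ring

/-! ### Poisson approximation by removing vertices -/

section Averages

open Finset
open scoped BigOperators

variable {V C : Type*} [Fintype V] [DecidableEq V] [Fintype C] [Nonempty C]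

/-- Exposing the color of the vertex `v` last: the edges at `v` contribute a constant factor, up to
an error of order `deg(v)² / c²`. -/
theorem norm_expect_prod_sub_mul_le (E : Finset (Sym2 V)) (hE : ∀ e ∈ E, ¬ e.IsDiag)
    {z : Sym2 V → ℂ} (hz : ∀ e, ‖z e‖ ≤ 1) (v : V) :
    ‖(𝔼 x : V → C, ∏ e ∈ E, monochromaticFactor z x e)
      - (𝔼 x : V → C, ∏ e ∈ E with v ∉ e, monochromaticFactor z x e)
        * (1 + (∑ e ∈ E with v ∈ e, (z e - 1)) / Fintype.card C)‖
      ≤ 4 * (#{e ∈ E | v ∈ e} : ℝ) ^ 2 / (Fintype.card C : ℝ) ^ 2 := by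
  classical
  set I := {e ∈ E | v ∈ e} with hI
  set A : (V → C) → ℂ := fun x => ∏ e ∈ E with v ∉ e, monochromaticFactor z x e with hA
  have hA1 (x : V → C) : ‖A x‖ ≤ 1 := by
    rw [hA, norm_prod]
    exact prod_le_one (fun _ _ => norm_nonneg _) fun e _ => norm_monochromaticFactor_le hz x e
  -- `o e` is the end of `e` opposite to `v`.
  obtain ⟨o, ho⟩ : ∃ o : Sym2 V → V, ∀ e, v ∈ e → s(v, o e) = e := by
    have : Nonempty V := ⟨v⟩
    choose! o ho using fun (e : Sym2 V) (h : v ∈ e) => Sym2.mem_iff_exists.1 h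
    exact ⟨o, fun e he => (ho e he).symm⟩
  have hoI (e) (he : e ∈ I) : s(v, o e) = e := ho e (mem_filter.1 he).2
  have hov (e) (he : e ∈ I) : o e ≠ v := by
    intro h
    have h1 := hoI e he
    rw [h] at h1
    exact hE e (mem_filter.1 he).1 (by rw [← h1]; exact Sym2.mk_isDiag_iff.2 rfl)
  let w : (V → C) → C → Sym2 V → ℂ := fun x a e => (if x (o e) = a then 1 else 0) * (z e - 1)
  have hw (x : V → C) (a : C) (e) (he : e ∈ I) :
      monochromaticFactor z (Function.update x v a) e = 1 + w x a e := by
    have h := monochromaticFactor_update_mk z x a (hov e he)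
    rwa [hoI e he] at h
  have hz2 (e) : ‖z e - 1‖ ≤ 2 := by
    have := norm_sub_le (z e) 1
    rw [norm_one] at this
    linarith [hz e]
  have hwn (x : V → C) (a : C) (e) : ‖w x a e‖ ≤ 2 * (if x (o e) = a then 1 else 0) := by
    simp only [w, norm_mul]
    split_ifs <;> simp [hz2]
  have hF : (𝔼 x : V → C, ∏ e ∈ E, monochromaticFactor z x e)
      = 𝔼 x : V → C, A x * 𝔼 a : C, ∏ e ∈ I, (1 + w x a e) := by
    rw [← expect_expect_update _ v]
    refine expect_congr rfl fun x _ => ?_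
    rw [mul_expect]
    refine expect_congr rfl fun a _ => ?_
    rw [← prod_filter_mul_prod_filter_not E (v ∈ ·), mul_comm]
    congr 1
    · exact prod_congr rfl fun e he =>
        monochromaticFactor_update_of_notMem z x a (mem_filter.1 he).2
    · exact prod_congr rfl fun e he => hw x a e he
  -- The averaged linear part does not depend on `x`, so it factors out of the average over
  -- colorings.
  have hlin (x : V → C) :
      1 + (∑ e ∈ I, (z e - 1)) / Fintype.card C = 𝔼 a : C, (1 + ∑ e ∈ I, w x a e) := by
    rw [expect_add_distrib, Fintype.expect_const, expect_sum_comm]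
    congr 1
    rw [sum_div]
    refine sum_congr rfl fun e _ => ?_
    simp only [w]
    rw [← expect_mul, expect_ite_eq_one, div_eq_inv_mul]
  have hdiff : (𝔼 x : V → C, ∏ e ∈ E, monochromaticFactor z x e)
      - (𝔼 x, A x) * (1 + (∑ e ∈ I, (z e - 1)) / Fintype.card C)
      = 𝔼 x : V → C, 𝔼 a : C, A x * (∏ e ∈ I, (1 + w x a e) - 1 - ∑ e ∈ I, w x a e) := by
    rw [hF, expect_mul, ← expect_sub_distrib]
    refine expect_congr rfl fun x _ => ?_
    rw [hlin x, ← mul_sub, ← expect_sub_distrib, mul_expect]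
    exact expect_congr rfl fun a _ => by ring
  rw [hdiff]
  calc _ ≤ 𝔼 x : V → C, 𝔼 a : C, ∑ p ∈ I.offDiag,
        4 * ((if x (o p.1) = a then (1 : ℝ) else 0) * (if x (o p.2) = a then 1 else 0)) := by
        refine (RCLike.norm_expect_le (K := ℂ)).trans (expect_le_expect fun x _ => ?_)
        refine (RCLike.norm_expect_le (K := ℂ)).trans (expect_le_expect fun a _ => ?_)
        rw [norm_mul]
        refine (mul_le_of_le_one_left (norm_nonneg _) (hA1 x)).trans ?_
        refine (norm_prod_one_add_sub_one_sub_sum_le I (w x a) fun e he => ?_).trans ?_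
        · rw [← hw x a e he]
          exact norm_monochromaticFactor_le hz _ _
        · refine sum_le_sum fun p _ => ?_
          refine (mul_le_mul (hwn x a p.1) (hwn x a p.2) (norm_nonneg _) ?_).trans_eq (by ring)
          split_ifs <;> norm_num
    _ = ∑ p ∈ I.offDiag, 4 * ((Fintype.card C : ℝ)⁻¹) ^ 2 := by
        simp_rw [expect_sum_comm]
        refine sum_congr rfl fun p hp => ?_
        simp only [← mul_expect]
        rw [expect_expect_ite_eq_mul_ite_eq]
        -- Distinct edges at `v` have distinct opposite ends.
        intro h
        rw [mem_offDiag] at hp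
        apply hp.2.2
        rw [← hoI _ hp.1, ← hoI _ hp.2.1, h]
    _ ≤ 4 * (#I : ℝ) ^ 2 / (Fintype.card C : ℝ) ^ 2 := by
        rw [sum_const, nsmul_eq_mul, inv_pow, ← div_eq_mul_inv, ← mul_div_assoc]
        gcongr ?_ / _
        have : (#I.offDiag : ℝ) ≤ (#I : ℝ) ^ 2 := by
          rw [offDiag_card, sq]
          exact_mod_cast Nat.sub_le _ _
        linarith

theorem norm_exp_le_one_of_re_nonpos {z : ℂ} (hz : z.re ≤ 0) : ‖Complex.exp z‖ ≤ 1 := by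
  rw [Complex.norm_exp]
  exact Real.exp_le_one_iff.2 hz

theorem re_sum_sub_one_div_nonpos {ι : Type*} (s : Finset ι) {z : ι → ℂ} (hz : ∀ e, ‖z e‖ ≤ 1)
    (c : ℕ) : ((∑ e ∈ s, (z e - 1)) / c).re ≤ 0 := by
  rw [Complex.div_natCast_re, Complex.re_sum]
  refine div_nonpos_of_nonpos_of_nonneg (sum_nonpos fun e _ => ?_) (Nat.cast_nonneg c)
  have := (Complex.re_le_norm (z e)).trans (hz e)
  simpa using this

/-- The generating function of the monochromatic edges is close to that of a Poisson process. -/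
theorem norm_expect_prod_sub_exp_le {z : Sym2 V → ℂ} (hz : ∀ e, ‖z e‖ ≤ 1) {D : ℝ} (hD : 0 ≤ D)
    (hDC : 2 * D ≤ Fintype.card C) (E : Finset (Sym2 V)) (hE : ∀ e ∈ E, ¬ e.IsDiag)
    (hED : 2 * (#E : ℝ) ≤ D ^ 2) :
    ‖(𝔼 x : V → C, ∏ e ∈ E, monochromaticFactor z x e)
      - Complex.exp ((∑ e ∈ E, (z e - 1)) / Fintype.card C)‖
      ≤ 8 * D * #E / (Fintype.card C : ℝ) ^ 2 := by
  -- `D` stays fixed while `E` shrinks; the bound is linear in `#E`, so the costs of the removals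
  -- add up.
  induction E using Finset.strongInduction with
  | H E ih =>
    rcases E.eq_empty_or_nonempty with rfl | hne
    · simp
    obtain ⟨v, hv, hdeg⟩ := exists_vertex_degree_sq_le E hne
    have hc : (0 : ℝ) < Fintype.card C := by exact_mod_cast Fintype.card_pos
    set c := Fintype.card C with hcdef
    set I := {e ∈ E | v ∈ e} with hI
    set J := {e ∈ E | v ∉ e} with hJ
    have hcard : (#I : ℝ) + #J = #E := by
      exact_mod_cast card_filter_add_card_filter_not (s := E) (v ∈ ·)
    have hID : (#I : ℝ) ≤ D := by
      refine abs_le_of_sq_le_sq' ?_ hD |>.2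
      exact le_trans (by exact_mod_cast hdeg) hED
    have hJE : J ⊂ E := by
      obtain ⟨e, he⟩ := hv
      exact filter_ssubset.2 ⟨e, (mem_filter.1 he).1, by simpa using (mem_filter.1 he).2⟩
    have hJ' := ih J hJE (fun e he => hE e (hJE.1 he)) (by
      have : (0 : ℝ) ≤ #I := Nat.cast_nonneg _
      linarith)
    have hstep := norm_expect_prod_sub_mul_le (C := C) E hE hz v
    rw [← hI, ← hJ, ← hcdef] at hstep
    set ζ := (∑ e ∈ I, (z e - 1)) / (c : ℂ) with hζ
    set θ := (∑ e ∈ J, (z e - 1)) / (c : ℂ) with hθ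
    set F := 𝔼 x : V → C, ∏ e ∈ E, monochromaticFactor z x e
    set G := 𝔼 x : V → C, ∏ e ∈ J, monochromaticFactor z x e with hG
    have hsum : (∑ e ∈ E, (z e - 1)) / (c : ℂ) = θ + ζ := by
      rw [hθ, hζ, ← add_div, add_comm, sum_filter_add_sum_filter_not]
    have hζre : ζ.re ≤ 0 := re_sum_sub_one_div_nonpos I hz c
    have hζn : ‖ζ‖ ≤ 2 * #I / c := by
      rw [hζ, norm_div, Complex.norm_natCast]
      gcongr
      refine (norm_sum_le _ _).trans ((sum_le_card_nsmul _ _ 2 fun e _ => ?_).trans_eq ?_)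
      · have := norm_sub_le (z e) 1
        rw [norm_one] at this
        linarith [hz e]
      · rw [nsmul_eq_mul, mul_comm]
    have hζ1 : ‖ζ‖ ≤ 1 := hζn.trans (by rw [div_le_one hc]; linarith)
    have hG1 : ‖G‖ ≤ 1 := by
      refine (RCLike.norm_expect_le (K := ℂ)).trans (expect_le univ_nonempty fun x _ => ?_)
      rw [norm_prod]
      exact prod_le_one (fun _ _ => norm_nonneg _) fun e _ => norm_monochromaticFactor_le hz x e
    have hexp : ‖Complex.exp ζ - 1 - ζ‖ ≤ 4 * (#I : ℝ) ^ 2 / (c : ℝ) ^ 2 := by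
      refine (Complex.norm_exp_sub_one_sub_id_le hζ1).trans ?_
      refine (pow_le_pow_left₀ (norm_nonneg _) hζn 2).trans_eq (by ring)
    -- The linearisation and the replacement of `1 + ζ` by `exp ζ` each cost `4 * #I² / c²`, whence
    -- the 8; `‖exp ζ‖ ≤ 1` keeps the inductive error from growing.
    have heq : F - Complex.exp (θ + ζ) = (F - G * (1 + ζ)) + (G - Complex.exp θ) * Complex.exp ζ
        - G * (Complex.exp ζ - 1 - ζ) := by
      rw [Complex.exp_add]; ring
    rw [hsum, heq]
    calc _ ≤ ‖F - G * (1 + ζ)‖ + ‖G - Complex.exp θ‖ * ‖Complex.exp ζ‖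
          + ‖G‖ * ‖Complex.exp ζ - 1 - ζ‖ := by
          refine (norm_sub_le _ _).trans ?_
          rw [norm_mul G]
          gcongr
          exact (norm_add_le _ _).trans_eq (by rw [norm_mul])
      _ ≤ 4 * (#I : ℝ) ^ 2 / (c : ℝ) ^ 2 + 8 * D * #J / (c : ℝ) ^ 2 * 1
          + 1 * (4 * (#I : ℝ) ^ 2 / (c : ℝ) ^ 2) := by
          gcongr
          exact norm_exp_le_one_of_re_nonpos hζre
      _ = (8 * (#I : ℝ) ^ 2 + 8 * D * #J) / (c : ℝ) ^ 2 := by ring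
      _ ≤ 8 * D * #E / (c : ℝ) ^ 2 := by
          gcongr
          -- `#I ≤ D` turns `#I²` into `D * #I`.
          rw [← hcard]
          nlinarith [(Nat.cast_nonneg #I : (0 : ℝ) ≤ #I)]

end Averages

/-! ### Characteristic function of the two counts -/

section Coloring

open scoped BigOperators

variable {Ω V : Type*} [MeasurableSpace Ω] {c : ℕ} {X : V → Ω → Fin c} {P : Measure Ω}

theorem IsUniformColoring.measurable_comp {β : Type*} [MeasurableSpace β] [Finite V]
    (hX : IsUniformColoring X P) (f : (V → Fin c) → β) : Measurable fun ω => f fun v => X v ω :=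
  (measurable_of_finite f).comp (measurable_pi_lambda _ hX.measurable)

/-- Expectations under a uniform coloring are averages over all colorings. -/
theorem IsUniformColoring.integral_eq_expect [Fintype V] [DecidableEq V] [IsProbabilityMeasure P]
    (hX : IsUniformColoring X P) (f : (V → Fin c) → ℂ) :
    ∫ ω, f (fun v => X v ω) ∂P = 𝔼 x, f x := by
  have hm : Measurable fun ω v => X v ω := measurable_pi_lambda _ hX.measurable
  have hpi := hX.indep.map_fun_eq_pi_map fun v => (hX.measurable v).aemeasurable
  have hpt (x : V → Fin c) : (P.map fun ω v => X v ω).real {x} = ((c : ℝ) ^ Fintype.card V)⁻¹ := by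
    have (v : V) : IsProbabilityMeasure (P.map (X v)) :=
      Measure.isProbabilityMeasure_map (hX.measurable v).aemeasurable
    rw [hpi, measureReal_def, Measure.pi_singleton, ENNReal.toReal_prod]
    have (v : V) : (P.map (X v) {x v}).toReal = (c : ℝ)⁻¹ := by
      rw [Measure.map_apply (hX.measurable v) (measurableSet_singleton _)]
      have h := hX.uniform v (x v)
      rw [show X v ⁻¹' {x v} = {ω | X v ω = x v} from rfl, h]
      simp
    simp [this]
  have hfin : IsFiniteMeasure (P.map fun ω v => X v ω) := Measure.isFiniteMeasure_map _ _
  rw [← integral_map (f := f) hm.aemeasurable (measurable_of_finite f).aestronglyMeasurable,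
    integral_fintype .of_finite]
  simp_rw [hpt]
  rw [← Finset.smul_sum, Finset.expect_eq_sum_div_card, div_eq_inv_mul, Complex.real_smul]
  simp

end Coloring

/-- The characteristic function of a pair of counts of monochromatic edges, as a product over
edges. -/
theorem cexp_monochromaticEdgeCount {V C : Type*} [Fintype V] (H₁ H₂ : SimpleGraph V) (x : V → C)
    (E : Finset (Sym2 V)) (h₁ : H₁.edgeSet ⊆ E) (h₂ : H₂.edgeSet ⊆ E) (a b : ℂ) :
    Complex.exp (monochromaticEdgeCount H₁ x * a + monochromaticEdgeCount H₂ x * b)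
      = ∏ e ∈ E, monochromaticFactor (fun e => Complex.exp (H₁.edgeSet.indicator (fun _ => a) e
          + H₂.edgeSet.indicator (fun _ => b) e)) x e := by
  classical
  have hcount (H : SimpleGraph V) (hH : H.edgeSet ⊆ E) (a : ℂ) :
      monochromaticEdgeCount H x * a
        = ∑ e ∈ E, if IsMonochromatic x e then H.edgeSet.indicator (fun _ => a) e else 0 := by
    have : {e | e ∈ H.edgeSet ∧ IsMonochromatic x e}
        = ((E.filter fun e => IsMonochromatic x e ∧ e ∈ H.edgeSet : Finset (Sym2 V)) :
          Set (Sym2 V)) := by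
      ext e
      simp only [Set.mem_ofPred_eq, Finset.coe_filter]
      exact ⟨fun h => ⟨hH h.1, h.2, h.1⟩, fun h => ⟨h.2.2, h.2.1⟩⟩
    rw [monochromaticEdgeCount, this, Set.ncard_coe_finset, ← nsmul_eq_mul, ← Finset.sum_const,
      Finset.sum_filter]
    refine Finset.sum_congr rfl fun e _ => ?_
    rw [Set.indicator_apply]
    split_ifs <;> simp_all
  rw [hcount H₁ h₁, hcount H₂ h₂, ← Finset.sum_add_distrib, Complex.exp_sum]
  refine Finset.prod_congr rfl fun e _ => ?_
  rw [monochromaticFactor]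
  split_ifs <;> simp

/-- On `A ∩ B`, `exp (a + b) - 1` is the sum of `exp a - 1`, `exp b - 1` and their product. Hence
only the three cardinalities with prescribed limits enter the exponent. -/
theorem sum_cexp_indicator_sub_one {α : Type*} (E : Finset α) {A B : Set α} (hA : A ⊆ E)
    (hB : B ⊆ E) (a b : ℂ) :
    ∑ e ∈ E, (Complex.exp (A.indicator (fun _ => a) e + B.indicator (fun _ => b) e) - 1)
      = A.ncard * (Complex.exp a - 1) + B.ncard * (Complex.exp b - 1)
        + (A ∩ B).ncard * ((Complex.exp a - 1) * (Complex.exp b - 1)) := by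
  classical
  have hcount (S : Set α) (hS : S ⊆ E) (a : ℂ) :
      S.ncard * a = ∑ e ∈ E, S.indicator (fun _ => a) e := by
    have : S = ((E.filter (· ∈ S) : Finset α) : Set α) := by
      ext e
      simp only [Finset.coe_filter, Set.mem_ofPred_eq]
      exact ⟨fun h => ⟨hS h, h⟩, fun h => h.2⟩
    rw [show S.ncard = (E.filter (· ∈ S)).card by
        conv_lhs => rw [this, Set.ncard_coe_finset], ← nsmul_eq_mul,
      ← Finset.sum_const, Finset.sum_filter]
    exact Finset.sum_congr rfl fun e _ => by rw [Set.indicator_apply]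
  rw [hcount A hA, hcount B hB, hcount _ (Set.inter_subset_left.trans hA),
    ← Finset.sum_add_distrib, ← Finset.sum_add_distrib]
  refine Finset.sum_congr rfl fun e _ => ?_
  simp only [Set.indicator_apply, Set.mem_inter_iff]
  by_cases h1 : e ∈ A <;> by_cases h2 : e ∈ B <;> simp [h1, h2, Complex.exp_add]
  ring

/-- The characteristic function of a pair of counts of monochromatic edges is close to that of a
Poisson limit, with an explicit error. -/
theorem IsUniformColoring.norm_integral_cexp_sub_le {Ω V : Type*} [MeasurableSpace Ω] [Finite V]
    {c : ℕ} {X : V → Ω → Fin c} {P : Measure Ω} [IsProbabilityMeasure P]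
    (hX : IsUniformColoring X P) (hc : 0 < c) (H₁ H₂ : SimpleGraph V) {a b : ℂ} (ha : a.re = 0)
    (hb : b.re = 0) {D : ℝ} (hD : 0 ≤ D) (hDc : 2 * D ≤ c)
    (hED : 2 * (H₁.edgeSet.ncard + H₂.edgeSet.ncard : ℝ) ≤ D ^ 2) :
    ‖(∫ ω, Complex.exp (monochromaticEdgeCount H₁ (fun v => X v ω) * a
        + monochromaticEdgeCount H₂ (fun v => X v ω) * b) ∂P)
      - Complex.exp ((H₁.edgeSet.ncard * (Complex.exp a - 1)
        + H₂.edgeSet.ncard * (Complex.exp b - 1) + (H₁.edgeSet ∩ H₂.edgeSet).ncard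
          * ((Complex.exp a - 1) * (Complex.exp b - 1))) / c)‖
      ≤ 8 * D * (H₁.edgeSet.ncard + H₂.edgeSet.ncard) / (c : ℝ) ^ 2 := by
  classical
  have := Fintype.ofFinite V
  have : NeZero c := ⟨hc.ne'⟩
  set E : Finset (Sym2 V) := {e | e ∈ H₁.edgeSet ∪ H₂.edgeSet} with hE
  have hEcoe : (E : Set (Sym2 V)) = H₁.edgeSet ∪ H₂.edgeSet := by ext; simp [hE]
  have h₁ : H₁.edgeSet ⊆ E := hEcoe ▸ Set.subset_union_left
  have h₂ : H₂.edgeSet ⊆ E := hEcoe ▸ Set.subset_union_right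
  have hcard : (E.card : ℝ) ≤ H₁.edgeSet.ncard + H₂.edgeSet.ncard := by
    rw [← Set.ncard_coe_finset, hEcoe]
    exact_mod_cast Set.ncard_union_le _ _
  have hdiag : ∀ e ∈ E, ¬ e.IsDiag := by
    intro e he
    have he' : e ∈ H₁.edgeSet ∪ H₂.edgeSet := by simpa [hE] using he
    rcases he' with h | h
    · exact H₁.not_isDiag_of_mem_edgeSet h
    · exact H₂.not_isDiag_of_mem_edgeSet h
  set z : Sym2 V → ℂ := fun e => Complex.exp (H₁.edgeSet.indicator (fun _ => a) e
    + H₂.edgeSet.indicator (fun _ => b) e) with hz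
  have hz1 (e) : ‖z e‖ ≤ 1 := by
    refine norm_exp_le_one_of_re_nonpos ?_
    simp only [Set.indicator_apply]
    split_ifs <;> simp [ha, hb]
  have key := norm_expect_prod_sub_exp_le (C := Fin c) hz1 hD (by simpa using hDc) E hdiag
    (by linarith)
  rw [sum_cexp_indicator_sub_one E h₁ h₂, Fintype.card_fin] at key
  rw [hX.integral_eq_expect (fun x => Complex.exp (monochromaticEdgeCount H₁ x * a
    + monochromaticEdgeCount H₂ x * b))]
  simp_rw [cexp_monochromaticEdgeCount H₁ H₂ _ E h₁ h₂]
  refine key.trans ?_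
  gcongr

/-! ### Continuity theorem on the lattice -/

/-- Weak convergence on `ℕ × ℕ` follows from convergence of the characteristic functions. -/
theorem tendsto_of_tendsto_integral_cexp {μ : ℕ → ProbabilityMeasure (ℕ × ℕ)}
    {ν : ProbabilityMeasure (ℕ × ℕ)}
    (h : ∀ s t : ℝ, Tendsto
      (fun n => ∫ p, Complex.exp (p.1 * (s * Complex.I) + p.2 * (t * Complex.I)) ∂(μ n).toMeasure)
      atTop (𝓝 (∫ p, Complex.exp (p.1 * (s * Complex.I) + p.2 * (t * Complex.I)) ∂ν.toMeasure))) :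
    Tendsto μ atTop (𝓝 ν) := by
  -- Distinct lattice points are at distance at least 1, so the embedding in the plane is closed;
  -- Lévy's theorem applies there, and Tietze extension transfers test functions.
  let φ : ℕ × ℕ → EuclideanSpace ℝ (Fin 2) := fun p => !₂[(p.1 : ℝ), (p.2 : ℝ)]
  have hφ : IsClosedEmbedding φ := by
    refine Metric.isClosedEmbedding_of_pairwise_le_dist (ε := 1) one_pos fun p q hpq => ?_
    have h0 := PiLp.norm_apply_le (φ p - φ q) 0
    have h1 := PiLp.norm_apply_le (φ p - φ q) 1
    change 1 ≤ dist (φ p) (φ q)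
    rw [dist_eq_norm]
    by_cases hp : p.1 = q.1
    · refine le_trans ?_ h1
      have := Nat.pairwise_one_le_dist (fun h => hpq (Prod.ext hp h) : p.2 ≠ q.2)
      simpa [φ, Nat.dist_eq, Real.norm_eq_abs] using this
    · refine le_trans ?_ h0
      have := Nat.pairwise_one_le_dist hp
      simpa [φ, Nat.dist_eq, Real.norm_eq_abs] using this
  have hφm : Measurable φ := measurable_from_prod_countable_right fun _ => by fun_prop
  have hchar (ρ : ProbabilityMeasure (ℕ × ℕ)) (t : EuclideanSpace ℝ (Fin 2)) :
      charFun (ρ.map hφm.aemeasurable).toMeasure t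
        = ∫ p, Complex.exp (p.1 * (t 0 * Complex.I) + p.2 * (t 1 * Complex.I)) ∂ρ.toMeasure := by
    rw [charFun_apply, ProbabilityMeasure.toMeasure_map,
      integral_map hφm.aemeasurable (by fun_prop)]
    refine integral_congr_ae (.of_forall fun p => ?_)
    simp only [φ, PiLp.inner_apply, Fin.sum_univ_two]
    congr 1
    simp
    ring
  have hlim : Tendsto (fun n => (μ n).map hφm.aemeasurable) atTop
      (𝓝 (ν.map hφm.aemeasurable)) := by
    refine ProbabilityMeasure.tendsto_of_tendsto_charFun fun t => ?_
    simp_rw [hchar]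
    exact h (t 0) (t 1)
  rw [ProbabilityMeasure.tendsto_iff_forall_integral_tendsto] at hlim ⊢
  intro f
  obtain ⟨g, -, hg⟩ := f.exists_extension_norm_eq_of_isClosedEmbedding hφ
  have hgf (ρ : ProbabilityMeasure (ℕ × ℕ)) :
      ∫ y, g y ∂(ρ.map hφm.aemeasurable).toMeasure = ∫ p, f p ∂ρ.toMeasure := by
    rw [ProbabilityMeasure.toMeasure_map,
      integral_map hφm.aemeasurable g.continuous.aestronglyMeasurable, ← hg]
    rfl
  simpa only [hgf] using hlim g

/-! ### Characteristic function of the Poisson limit -/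

theorem integral_cexp_poissonMeasure (r : ℝ≥0) (t : ℝ) :
    ∫ k : ℕ, Complex.exp (k * (t * Complex.I)) ∂(poissonMeasure r)
      = Complex.exp (r * (Complex.exp (t * Complex.I) - 1)) := by
  rw [← charFun_map_cast_poissonMeasure, charFun_apply_real,
    integral_map .of_discrete (by fun_prop)]
  refine integral_congr_ae (.of_forall fun k => ?_)
  simp only [Complex.ofReal_natCast]
  congr 1
  ring

theorem ProbabilityTheory.HasLaw.integral_cexp_poissonMeasure {Ω : Type*} [MeasurableSpace Ω] {Q : Measure Ω}
    {Z : Ω → ℕ} {r : ℝ≥0} (hZ : HasLaw Z (poissonMeasure r) Q) (t : ℝ) :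
    ∫ ω, Complex.exp (Z ω * (t * Complex.I)) ∂Q
      = Complex.exp (r * (Complex.exp (t * Complex.I) - 1)) := by
  rw [← _root_.integral_cexp_poissonMeasure,
    ← hZ.integral_comp (f := fun k : ℕ => Complex.exp (k * (t * Complex.I))) (by fun_prop)]
  rfl

/-- The characteristic function of a pair of Poisson variables with a common component. -/
theorem integral_cexp_add_common_poisson {Ω : Type*} [MeasurableSpace Ω] {Q : Measure Ω}
    {Z₁ Z₂ Z₁₂ : Ω → ℕ} {r₁ r₂ r₁₂ : ℝ≥0} (hZ₁ : HasLaw Z₁ (poissonMeasure r₁) Q)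
    (hZ₂ : HasLaw Z₂ (poissonMeasure r₂) Q) (hZ₁₂ : HasLaw Z₁₂ (poissonMeasure r₁₂) Q)
    (hZ : iIndepFun ![Z₁, Z₂, Z₁₂] Q) (s t : ℝ) :
    ∫ ω, Complex.exp ((Z₁ ω + Z₁₂ ω : ℕ) * (s * Complex.I)
        + (Z₂ ω + Z₁₂ ω : ℕ) * (t * Complex.I)) ∂Q
      = Complex.exp (r₁ * (Complex.exp (s * Complex.I) - 1) + r₂ * (Complex.exp (t * Complex.I) - 1)
        + r₁₂ * (Complex.exp (s * Complex.I) * Complex.exp (t * Complex.I) - 1)) := by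
  have hm : ∀ i, AEMeasurable (![Z₁, Z₂, Z₁₂] i) Q := by
    intro i
    fin_cases i
    exacts [hZ₁.aemeasurable, hZ₂.aemeasurable, hZ₁₂.aemeasurable]
  -- The common component enters both coordinates, hence has frequency `s + t`.
  have h := hZ.integral_fun_prod_comp
    (f := fun i (k : ℕ) => Complex.exp (k * ((![s, t, s + t] i : ℝ) * Complex.I))) hm
    (fun i => (measurable_of_countable _).aestronglyMeasurable)
  simp only [Fin.prod_univ_three, Matrix.cons_val_zero, Matrix.cons_val_one, Matrix.cons_val] at h
  rw [hZ₁.integral_cexp_poissonMeasure, hZ₂.integral_cexp_poissonMeasure,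
    hZ₁₂.integral_cexp_poissonMeasure] at h
  rw [← Complex.exp_add (s * Complex.I), ← add_mul, ← Complex.ofReal_add, Complex.exp_add,
    Complex.exp_add, ← h]
  refine integral_congr_ae (.of_forall fun ω => ?_)
  simp only [← Complex.exp_add]
  congr 1
  push_cast
  ring

/-! ### Passage to the limit -/

theorem corollary1p6
    -- the 2-multiplexes: two graphs on the same finite vertex set, and the numbers of colors
    {V : ℕ → Type*} [∀ n, Finite (V n)] (H₁ H₂ : (n : ℕ) → SimpleGraph (V n)) (c : ℕ → ℕ)
    (hc : Tendsto c atTop atTop)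
    -- the random colorings
    {Ω : ℕ → Type*} [∀ n, MeasurableSpace (Ω n)] (P : (n : ℕ) → Measure (Ω n))
    [∀ n, IsProbabilityMeasure (P n)] (X : (n : ℕ) → V n → Ω n → Fin (c n))
    (hX : ∀ n, IsUniformColoring (X n) (P n))
    -- the limits of the edge densities
    (lam₁ lam₂ lam₁₂ : ℝ≥0) (hle₁ : lam₁₂ ≤ lam₁) (hle₂ : lam₁₂ ≤ lam₂)
    (h₁ : Tendsto (fun n => ((H₁ n).edgeSet.ncard : ℝ) / (c n : ℝ)) atTop (𝓝 (lam₁ : ℝ)))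
    (h₂ : Tendsto (fun n => ((H₂ n).edgeSet.ncard : ℝ) / (c n : ℝ)) atTop (𝓝 (lam₂ : ℝ)))
    (h₁₂ : Tendsto (fun n => (((H₁ n).edgeSet ∩ (H₂ n).edgeSet).ncard : ℝ) / (c n : ℝ)) atTop
      (𝓝 (lam₁₂ : ℝ)))
    -- independent Poisson variables
    {Ω' : Type*} [MeasurableSpace Ω'] (Q : Measure Ω') [IsProbabilityMeasure Q]
    (Z₁ Z₂ Z₁₂ : Ω' → ℕ)
    (hZ₁ : HasLaw Z₁ (poissonMeasure (lam₁ - lam₁₂)) Q)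
    (hZ₂ : HasLaw Z₂ (poissonMeasure (lam₂ - lam₁₂)) Q)
    (hZ₁₂ : HasLaw Z₁₂ (poissonMeasure lam₁₂) Q)
    (hZ : iIndepFun ![Z₁, Z₂, Z₁₂] Q) :
    TendstoInDistribution
      (fun n ω => (monochromaticEdgeCount (H₁ n) (fun v => X n v ω),
        monochromaticEdgeCount (H₂ n) (fun v => X n v ω)))
      atTop (fun ω => (Z₁ ω + Z₁₂ ω, Z₂ ω + Z₁₂ ω)) P Q := by
  have hmeas n := (hX n).measurable_comp fun x =>
    (monochromaticEdgeCount (H₁ n) x, monochromaticEdgeCount (H₂ n) x)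
  have hZm : AEMeasurable (fun ω => (Z₁ ω + Z₁₂ ω, Z₂ ω + Z₁₂ ω)) Q :=
    (hZ₁.aemeasurable.add hZ₁₂.aemeasurable).prodMk (hZ₂.aemeasurable.add hZ₁₂.aemeasurable)
  refine ⟨fun n => (hmeas n).aemeasurable, hZm, tendsto_of_tendsto_integral_cexp fun s t => ?_⟩
  simp only [ProbabilityMeasure.coe_mk]
  rw [integral_map hZm (measurable_of_countable _).aestronglyMeasurable,
    integral_cexp_add_common_poisson hZ₁ hZ₂ hZ₁₂ hZ]
  simp_rw [fun n => integral_map (hmeas n).aemeasurable (μ := P n)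
    (measurable_of_countable fun p : ℕ × ℕ => Complex.exp (p.1 * (s * Complex.I)
      + p.2 * (t * Complex.I))).aestronglyMeasurable]
  set a : ℂ := s * Complex.I with ha
  set b : ℂ := t * Complex.I with hb
  have hcR : Tendsto (fun n => ((c n : ℝ))⁻¹) atTop (𝓝 0) :=
    tendsto_inv_atTop_zero.comp (tendsto_natCast_atTop_atTop.comp hc)
  set M : ℕ → ℝ := fun n => (H₁ n).edgeSet.ncard + (H₂ n).edgeSet.ncard with hM
  have hM0 (n) : 0 ≤ M n := by positivity
  have hMc : Tendsto (fun n => M n / c n) atTop (𝓝 (lam₁ + lam₂)) := by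
    simpa only [hM, add_div] using h₁.add h₂
  -- `D = √(2 * M n)` is the least value the error bound admits. As `M n / c n` converges, `D / c n
  -- → 0`: eventually `2 * D ≤ c n`, and the error `8 * (D / c n) * (M n / c n)` vanishes.
  have hDc : Tendsto (fun n => √(2 * M n) / c n) atTop (𝓝 0) := by
    have h : Tendsto (fun n => √(2 * (M n / c n) * (c n : ℝ)⁻¹)) atTop (𝓝 0) := by
      simpa using ((hMc.const_mul 2).mul hcR).sqrt
    refine h.congr fun n => ?_
    rw [show 2 * (M n / c n) * (c n : ℝ)⁻¹ = 2 * M n / (c n : ℝ) ^ 2 by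
        rw [sq, div_mul_eq_div_div]; ring,
      Real.sqrt_div' _ (sq_nonneg _), Real.sqrt_sq (Nat.cast_nonneg _)]
  have herr : Tendsto (fun n => 8 * √(2 * M n) * M n / (c n : ℝ) ^ 2) atTop (𝓝 0) := by
    have h := (hDc.mul hMc).const_mul 8
    rw [zero_mul, mul_zero] at h
    exact h.congr fun n => by ring
  have hexp : Tendsto (fun n => Complex.exp (((H₁ n).edgeSet.ncard * (Complex.exp a - 1)
      + (H₂ n).edgeSet.ncard * (Complex.exp b - 1) + ((H₁ n).edgeSet ∩ (H₂ n).edgeSet).ncard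
        * ((Complex.exp a - 1) * (Complex.exp b - 1))) / c n)) atTop
      (𝓝 (Complex.exp ((lam₁ - lam₁₂ : ℝ≥0) * (Complex.exp a - 1)
        + (lam₂ - lam₁₂ : ℝ≥0) * (Complex.exp b - 1)
        + lam₁₂ * (Complex.exp a * Complex.exp b - 1)))) := by
    have hC {u : ℕ → ℝ} {l : ℝ} (h : Tendsto u atTop (𝓝 l)) :
        Tendsto (fun n => (u n : ℂ)) atTop (𝓝 (l : ℂ)) :=
      (Complex.continuous_ofReal.tendsto _).comp h
    have h := (((hC h₁).mul_const (Complex.exp a - 1)).add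
      ((hC h₂).mul_const (Complex.exp b - 1))).add
      ((hC h₁₂).mul_const ((Complex.exp a - 1) * (Complex.exp b - 1)))
    refine (Complex.continuous_exp.tendsto' _ _ ?_).comp (h.congr fun n => ?_)
    -- `hle₁` and `hle₂` make the truncated subtractions genuine; then `exp a * exp b - 1` is
    -- expanded as in `sum_cexp_indicator_sub_one`.
    · rw [NNReal.coe_sub hle₁, NNReal.coe_sub hle₂]
      congr 1
      push_cast
      ring
    · push_cast
      ring
  refine tendsto_of_tendsto_of_dist hexp (squeeze_zero' (.of_forall fun _ => dist_nonneg) ?_ herr)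
  filter_upwards [hc.eventually_gt_atTop 0, hDc.eventually_lt_const (by norm_num : (0 : ℝ) < 1 / 2)]
    with n hn hDn
  have hn' : (0 : ℝ) < c n := by exact_mod_cast hn
  rw [dist_comm, dist_eq_norm]
  rw [div_lt_iff₀ hn'] at hDn
  exact (hX n).norm_integral_cexp_sub_le hn (H₁ n) (H₂ n) (by simp [ha]) (by simp [hb])
    (Real.sqrt_nonneg _) (by linarith) (by rw [Real.sq_sqrt (by have := hM0 n; linarith)])
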